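/- **Theorem.** Let $k>1$ and let the torus $T^2=(\mathbb R/2\pi\mathbb Z)^2$, with angular coordinates $(r,\theta)$, carry the metric $dr^2+(k+\cos r)^2d\theta^2$. Let $S^2\subset\mathbb R^3$ be the unit sphere with its induced metric, and let $(\rho,\phi)$ stand for the point $(\sin\rho,\ \cos\rho\cos\phi,\ \cos\rho\sin\phi)$ of $S^2$, so that the metric is $d\rho^2+\cos^2\!\rho\,d\phi^2$. For a smooth map $\varphi$ from an open subset of $(T^2,g)$ to $S^2$, let $$\tau(\varphi)=\mathrm{Tr}_g\nabla d\varphi,\qquad \tau_2(\varphi)=\mathrm{Tr}_g\big(\nabla^{\varphi}\nabla^{\varphi}-\nabla^{\varphi}_{\nabla^{T^2}}\big)\tau(\varphi)-\mathrm{Tr}_g R^{S^2}\big(d\varphi,\tau(\varphi)\big)d\varphi,$$ where $R(X,Y)Z=[\nabla_X,\nabla_Y]Z-\nabla_{[X,Y]}Z$; the map is *harmonic* if $\tau(\varphi)=0$ and *biharmonic* if $\tau_2(\varphi)=0$. Let $a,b,c,m,n,l\in\mathbb R$, let $W\subseteq\mathbb R^2$ be open with image $U\subseteq T^2$, and let $\varphi:T^2\to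 S^2$ be a map such that, for all $(r,\theta)\in W$, the image under $\varphi$ of the class of $(r,\theta)$ is the point $$(\rho,\phi)=(ar+b\theta+c,\ mr+n\theta+l).$$ Then $\varphi$ is biharmonic on $U$ if and only if it is harmonic on $U$. In particular (with $W=\mathbb R^2$, so that $U=T^2$), no map $T^2\to S^2$ of this form is proper biharmonic, i.e. biharmonic but not harmonic. -/

import Mathlib

open scoped ContDiff

namespace TorusSphere

noncomputable section

/-- The ambient Euclidean space of the round sphere. -/
abbrev E3 : Type := EuclideanSpace ℝ (Fin 3)

/-- The unit sphere `S²`, with the Riemannian metric induced from Euclidean space. -/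
abbrev S2 : Type := Metric.sphere (0 : E3) 1

/-- The torus `T² = (ℝ / 2πℤ) × (ℝ / 2πℤ)`. -/
abbrev T2 : Type := Real.Angle × Real.Angle

/-- The coordinate plane of `(r, θ)`, where `r` is the coordinate `0` and `θ` the coordinate `1`. -/
abbrev Plane : Type := Fin 2 → ℝ

/-- The universal covering `(r, θ) ↦ (r mod 2π, θ mod 2π)`; its local inverses are the
angular charts of the torus. -/
def toTorus (x : Plane) : T2 := ((x 0 : Real.Angle), (x 1 : Real.Angle))

/-- The point of `S²` with coordinates `(ρ, φ)`, namely `(sin ρ, cos ρ cos φ, cos ρ sin φ)`.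
In these coordinates the induced metric is `dρ² + cos² ρ dφ²`. -/
def spherePoint (ρ φ : ℝ) : S2 :=
  ⟨!₂[Real.sin ρ, Real.cos ρ * Real.cos φ, Real.cos ρ * Real.sin φ], by
    rw [mem_sphere_zero_iff_norm, EuclideanSpace.norm_eq, Real.sqrt_eq_one]
    simp only [Fin.sum_univ_three, Real.norm_eq_abs, sq_abs]
    simp
    linear_combination (Real.cos ρ) ^ 2 * Real.sin_sq_add_cos_sq φ + Real.sin_sq_add_cos_sq ρ⟩

/-- The matrix of `dr² + (k + cos r)² dθ²` in the frame `∂/∂r, ∂/∂θ`. -/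
def torusMetric (k : ℝ) (p : T2) : Matrix (Fin 2) (Fin 2) ℝ :=
  !![1, 0; 0, (k + p.1.cos) ^ 2]

/-- The partial derivative in the `i`-th coordinate. -/
def partialD {V : Type*} [NormedAddCommGroup V] [NormedSpace ℝ V]
    (i : Fin 2) (F : Plane → V) (x : Plane) : V :=
  fderiv ℝ F x (Pi.single i 1)

/-- The Christoffel symbol `Γ^l_{ij}` of a metric `g` in coordinates. -/
def christoffel (g : Plane → Matrix (Fin 2) (Fin 2) ℝ) (l i j : Fin 2) (x : Plane) : ℝ :=
  (1 / 2) * ∑ s, (g x)⁻¹ l s *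
    (partialD i (fun y => g y j s) x + partialD j (fun y => g y i s) x
      - partialD s (fun y => g y i j) x)

/-- For `p` in the unit sphere, the orthogonal projection onto the tangent plane `p^⊥`. -/
def tangentProj (p v : E3) : E3 := v - (inner ℝ p v : ℝ) • p

/-- The Levi-Civita connection `∇_X Z` of the sphere: the tangential part of the Euclidean
derivative. Vector fields on the sphere are given by extensions to the ambient space; for `X`
tangent to the sphere, the values on the sphere do not depend on the extension. -/
def sphereConn (X Z : E3 → E3) (p : E3) : E3 :=
  tangentProj p (fderiv ℝ Z p (X p))

/-- The curvature operator `R(X, Y) Z = [∇_X, ∇_Y] Z - ∇_{[X, Y]} Z` of the sphere. -/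
def sphereCurvField (X Y Z : E3 → E3) (p : E3) : E3 :=
  sphereConn X (sphereConn Y Z) p - sphereConn Y (sphereConn X Z) p
    - sphereConn (VectorField.lieBracket ℝ X Y) Z p

/-- The curvature operator of the sphere on vectors `u, v, w` tangent to the sphere at `p`,
computed with the tangent vector fields `q ↦ tangentProj q u` and so on, which extend them. -/
def sphereCurv (p u v w : E3) : E3 :=
  sphereCurvField (fun q => tangentProj q u) (fun q => tangentProj q v)
    (fun q => tangentProj q w) p

/-- For a map `F` into the sphere and a vector field `V` along `F`, the covariant derivative
`∇^F_{∂_i} V` for the pull-back of the Levi-Civita connection of the sphere. -/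
def covAlong (F : Plane → E3) (i : Fin 2) (V : Plane → E3) (x : Plane) : E3 :=
  tangentProj (F x) (partialD i V x)

/-- The tension field `Tr_g ∇ dF` of a map `F` from the plane with metric `g` into the sphere. -/
def tension (g : Plane → Matrix (Fin 2) (Fin 2) ℝ) (F : Plane → E3) (x : Plane) : E3 :=
  ∑ i, ∑ j, (g x)⁻¹ i j •
    (covAlong F i (partialD j F) x - ∑ l, christoffel g l i j x • partialD l F x)

/-- The bitension field `Tr_g (∇^F ∇^F - ∇^F_∇) τ - Tr_g R(dF, τ) dF`, with `τ` the tension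
field of `F`. -/
def bitension (g : Plane → Matrix (Fin 2) (Fin 2) ℝ) (F : Plane → E3) (x : Plane) : E3 :=
  (∑ i, ∑ j, (g x)⁻¹ i j •
    (covAlong F i (covAlong F j (tension g F)) x
      - ∑ l, christoffel g l i j x • covAlong F l (tension g F) x))
  - ∑ i, ∑ j, (g x)⁻¹ i j •
      sphereCurv (F x) (partialD i F x) (tension g F x) (partialD j F x)

/-- A map `f` from the torus into the sphere, read in the angular coordinates `(r, θ)`. -/
def lift (f : T2 → S2) (x : Plane) : E3 := (f (toTorus x) : E3)

/-- `f` is smooth on the open set `U` of the torus. -/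
def IsSmoothOn (f : T2 → S2) (U : Set T2) : Prop :=
  ContDiffOn ℝ ∞ (lift f) (toTorus ⁻¹' U)

/-- `f : (T², g) → S²` is a harmonic map on the open set `U`: it is smooth there and its
tension field vanishes. -/
def IsHarmonicOn (g : T2 → Matrix (Fin 2) (Fin 2) ℝ) (f : T2 → S2) (U : Set T2) : Prop :=
  IsSmoothOn f U ∧
    ∀ x : Plane, toTorus x ∈ U → tension (fun y => g (toTorus y)) (lift f) x = 0

/-- `f : (T², g) → S²` is a biharmonic map on the open set `U`: it is smooth there and its
bitension field vanishes. -/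
def IsBiharmonicOn (g : T2 → Matrix (Fin 2) (Fin 2) ℝ) (f : T2 → S2) (U : Set T2) : Prop :=
  IsSmoothOn f U ∧
    ∀ x : Plane, toTorus x ∈ U → bitension (fun y => g (toTorus y)) (lift f) x = 0

end

end TorusSphere

/-!
Being harmonic or biharmonic is local, and near any point over `U` the map lifts to an affine map
`(ρ, φ) = (a r + b θ + c, m r + n θ + l)` of the plane, up to a change of `c` and `l`
(`exists_eventually_lift_eq_model`). In the orthonormal frame `∂/∂ρ`, `(cos ρ)⁻¹ ∂/∂φ`, which
extends smoothly over the poles, the tension field has the components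

* `A = a p + sin ρ cos ρ (m² + n² v²)`,
* `B = cos ρ m p - 2 sin ρ (a m + b n v²)`,

where `w = k + cos r`, `p = w' / w` and `v = 1 / w` (`tension_model`). As `p' = k v - 1 - p²` and
`v' = -p v`, all further derivatives are polynomials in `p`, `v`, `sin ρ`, `cos ρ`; together with
`R(X, Y) Z = ⟨Y, Z⟩ X - ⟨X, Z⟩ Y` on the sphere (`sphereCurv_eq`) this gives the bitension field
(`bitension_model`). A harmonic map is biharmonic, since the bitension is linear in the tension.

For the converse, the components of the bitension are trigonometric expressions in `r` and `ρ`
that extend to entire functions, so that they vanish everywhere once they vanish near a point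
(`entire_eq_zero`). Their frequencies are compared through the growth along the negative imaginary
axis (`HasLead`).

* If `b ≠ 0`, then `r` and `ρ` are independent variables. The coefficient of `sin 4ρ` in the first
  component is `(m² + n² v²)² / 4`, whence `m = n = 0`, and what remains is
  `a (1 - k²) p v²`, whence `a = 0`; then `A = B = 0` (`coeffs_eq_zero_of_ne_zero`).
* If `a = b = 0`, then `ρ` is constant and elementary comparisons in `r` give `cos ρ m = 0` and
  `sin ρ cos ρ n = 0`, that is `A = B = 0` (`tension_eq_zero_of_const`).
* If `b = 0` and `a ≠ 0`, the bitension cannot vanish identically (`exists_profile_ne_zero`). One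
  may take `a > 0`. Multiplied by `w⁴`, the first component has highest frequency `4a + 4` unless
  `m = 0`. For `m = 0` and `n ≠ 0` the frequencies `2a + 2` and `4a` both occur with nonzero
  coefficients, and one of them is the highest if `a ≠ 1`; if `a = 1` they may cancel, but the
  part that changes sign under `r ↦ r + π` still contains the frequency `3`. For `m = n = 0` the
  function is `a (1 - k²) w w'`.
-/

namespace TorusSphere

open Filter Topology

/-! ### Partial derivatives -/

section Calculus

variable {V : Type*} [NormedAddCommGroup V] [NormedSpace ℝ V] {i : Fin 2} {x : Plane}

/-- `F` is differentiable at `x` and its `i`-th partial derivative there is `v`. -/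
def HasPartial (i : Fin 2) (F : Plane → V) (v : V) (x : Plane) : Prop :=
  DifferentiableAt ℝ F x ∧ partialD i F x = v

theorem HasPartial.congr {F : Plane → V} {v w : V} (h : HasPartial i F v x) (e : v = w) :
    HasPartial i F w x := e ▸ h

theorem hasPartial_of_hasFDerivAt {F : Plane → V} {F' : Plane →L[ℝ] V} (h : HasFDerivAt F F' x) :
    HasPartial i F (F' (Pi.single i 1)) x :=
  ⟨h.differentiableAt, by rw [partialD, h.fderiv]⟩

theorem HasPartial.hasFDerivAt {F : Plane → V} {v : V} (h : HasPartial i F v x) :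
    HasFDerivAt F (fderiv ℝ F x) x := h.1.hasFDerivAt

theorem hasPartial_const (v : V) : HasPartial i (fun _ => v) 0 x := by
  simpa using hasPartial_of_hasFDerivAt (i := i) (hasFDerivAt_const v x)

theorem hasPartial_coord (j : Fin 2) :
    HasPartial i (fun y => y j) (if j = i then 1 else 0) x := by
  have := hasPartial_of_hasFDerivAt (i := i)
    (ContinuousLinearMap.proj (R := ℝ) (φ := fun _ : Fin 2 => ℝ) j).hasFDerivAt (x := x)
  refine this.congr ?_
  simp [Pi.single_apply]

theorem HasPartial.add {F G : Plane → V} {v w : V} (hF : HasPartial i F v x)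
    (hG : HasPartial i G w x) : HasPartial i (fun y => F y + G y) (v + w) x := by
  refine (hasPartial_of_hasFDerivAt (hF.hasFDerivAt.add hG.hasFDerivAt)).congr ?_
  rw [← hF.2, ← hG.2]; rfl

theorem HasPartial.sub {F G : Plane → V} {v w : V} (hF : HasPartial i F v x)
    (hG : HasPartial i G w x) : HasPartial i (fun y => F y - G y) (v - w) x := by
  refine (hasPartial_of_hasFDerivAt (hF.hasFDerivAt.sub hG.hasFDerivAt)).congr ?_
  rw [← hF.2, ← hG.2]; rfl

theorem HasPartial.smul {u : Plane → ℝ} {F : Plane → V} {u' : ℝ} {v : V}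
    (hu : HasPartial i u u' x) (hF : HasPartial i F v x) :
    HasPartial i (fun y => u y • F y) (u x • v + u' • F x) x := by
  refine (hasPartial_of_hasFDerivAt (hu.hasFDerivAt.smul hF.hasFDerivAt)).congr ?_
  rw [← hu.2, ← hF.2]; rfl

theorem HasPartial.mul {u w : Plane → ℝ} {u' w' : ℝ}
    (hu : HasPartial i u u' x) (hw : HasPartial i w w' x) :
    HasPartial i (fun y => u y * w y) (u x * w' + u' * w x) x := hu.smul hw

theorem HasPartial.pow_two {u : Plane → ℝ} {u' : ℝ} (hu : HasPartial i u u' x) :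
    HasPartial i (fun y => u y ^ 2) (2 * u x * u') x := by
  have h : (fun y => u y ^ 2) = fun y => u y * u y := by funext y; ring
  rw [h]
  exact (hu.mul hu).congr (by ring)

theorem HasPartial.comp {u : Plane → ℝ} {u' : ℝ} {f : ℝ → ℝ} {f' : ℝ}
    (hf : HasDerivAt f f' (u x)) (hu : HasPartial i u u' x) :
    HasPartial i (fun y => f (u y)) (f' * u') x := by
  refine (hasPartial_of_hasFDerivAt (hf.comp_hasFDerivAt x hu.hasFDerivAt)).congr ?_
  rw [← hu.2]; rfl

theorem partialD_congr {F G : Plane → V} (h : F =ᶠ[𝓝 x] G) (i : Fin 2) :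
    partialD i F =ᶠ[𝓝 x] partialD i G :=
  (h.fderiv (𝕜 := ℝ)).mono fun y hy => by simp only [partialD, hy]

end Calculus

/-! ### Locality of the tension and bitension fields -/

section Locality

variable {g : Plane → Matrix (Fin 2) (Fin 2) ℝ} {F G : Plane → E3} {x : Plane}

theorem covAlong_congr {V W : Plane → E3} (h : F =ᶠ[𝓝 x] G) (hV : V =ᶠ[𝓝 x] W) (i : Fin 2) :
    covAlong F i V =ᶠ[𝓝 x] covAlong G i W := by
  filter_upwards [h, partialD_congr hV i] with y h1 h2
  simp only [covAlong, h1, h2]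

theorem tension_congr (h : F =ᶠ[𝓝 x] G) : tension g F =ᶠ[𝓝 x] tension g G := by
  have h1 := fun j => partialD_congr h j
  have h2 := fun i j => covAlong_congr h (h1 j) i
  filter_upwards [h1 0, h1 1, h2 0 0, h2 0 1, h2 1 0, h2 1 1] with y a0 a1 b00 b01 b10 b11
  simp only [tension, Fin.sum_univ_two, a0, a1, b00, b01, b10, b11]

theorem bitension_congr (h : F =ᶠ[𝓝 x] G) : bitension g F x = bitension g G x := by
  have ht := tension_congr (g := g) h
  have h1 := fun j => (partialD_congr h j).eq_of_nhds
  have h2 := fun j => covAlong_congr h ht j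
  have h3 := fun i j => (covAlong_congr h (h2 j) i).eq_of_nhds
  simp only [bitension, h1, h3, fun j => (h2 j).eq_of_nhds, ht.eq_of_nhds, h.eq_of_nhds]

end Locality

/-! ### Geometry of the sphere -/

theorem tangentProj_add (p u v : E3) :
    tangentProj p (u + v) = tangentProj p u + tangentProj p v := by
  simp only [tangentProj, inner_add_right, add_smul]; abel

theorem tangentProj_smul (p u : E3) (t : ℝ) :
    tangentProj p (t • u) = t • tangentProj p u := by
  simp only [tangentProj, inner_smul_right, smul_sub, mul_smul]

theorem tangentProj_zero (p : E3) : tangentProj p 0 = 0 := by simp [tangentProj]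

theorem tangentProj_of_inner_eq_zero {p u : E3} (h : inner ℝ p u = 0) : tangentProj p u = u := by
  simp [tangentProj, h]

theorem tangentProj_self {p : E3} (h : ‖p‖ = 1) : tangentProj p p = 0 := by
  simp [tangentProj, h]

theorem fderiv_tangentProj_left (u p h : E3) :
    fderiv ℝ (fun q => tangentProj q u) p h = -((inner ℝ p u : ℝ) • h + (inner ℝ h u : ℝ) • p) := by
  have h1 : DifferentiableAt ℝ (fun q : E3 => (inner ℝ q u : ℝ)) p :=
    differentiableAt_id.inner ℝ (differentiableAt_const u)
  unfold tangentProj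
  rw [fderiv_const_sub, fderiv_fun_smul h1 differentiableAt_fun_id]
  simp [fderiv_inner_apply ℝ differentiableAt_fun_id (differentiableAt_const u)]

/-- The second covariant derivative of the fields `q ↦ tangentProj q _` at a point of the sphere. -/
theorem sphereConn_sphereConn_tangentProj {p u v w : E3} (hp : ‖p‖ = 1) (hu : inner ℝ p u = 0)
    (hv : inner ℝ p v = 0) (hw : inner ℝ p w = 0) :
    sphereConn (fun q => tangentProj q u)
      (sphereConn (fun q => tangentProj q v) (fun q => tangentProj q w)) p
    = -((inner ℝ u w : ℝ) • v) := by
  obtain ⟨γ, hγ, hγp, hN⟩ : ∃ γ : E3 → ℝ, DifferentiableAt ℝ γ p ∧ γ p = 0 ∧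
      sphereConn (fun q => tangentProj q v) (fun q => tangentProj q w)
        = fun q => γ q • q - (inner ℝ q w : ℝ) • v := by
    have hd : ∀ z : E3, DifferentiableAt ℝ (fun q : E3 => (inner ℝ q z : ℝ)) p := fun z =>
      differentiableAt_id.inner ℝ (differentiableAt_const z)
    have hq : DifferentiableAt ℝ (fun q : E3 => (inner ℝ q q : ℝ)) p :=
      differentiableAt_id.inner ℝ differentiableAt_id
    refine ⟨fun q => (2 * inner ℝ q v * inner ℝ q w - inner ℝ v w) * (1 - inner ℝ q q)
      + inner ℝ q w * inner ℝ q v, ?_, ?_, ?_⟩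
    · exact (((((hd v).const_mul 2).mul (hd w)).sub_const _).mul (hq.const_sub 1)).add
        ((hd w).mul (hd v))
    · simp [hw, hp]
    · funext q
      rw [sphereConn, fderiv_tangentProj_left]
      simp only [tangentProj, inner_neg_right, inner_add_right, inner_smul_right, inner_sub_right,
        inner_sub_left, real_inner_smul_left]
      module
  have hi : DifferentiableAt ℝ (fun q : E3 => (inner ℝ q w : ℝ)) p :=
    differentiableAt_id.inner ℝ (differentiableAt_const w)
  rw [hN, sphereConn, fderiv_fun_sub (hγ.fun_smul differentiableAt_fun_id) (hi.smul_const v),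
    fderiv_fun_smul hγ differentiableAt_fun_id, fderiv_smul_const hi]
  simp [fderiv_inner_apply ℝ differentiableAt_fun_id (differentiableAt_const w), hγp,
    tangentProj, hu, hv, hp, inner_sub_right, inner_smul_right]

/-- The unit sphere has constant sectional curvature `1`. -/
theorem sphereCurv_eq {p u v w : E3} (hp : ‖p‖ = 1) (hu : inner ℝ p u = 0) (hv : inner ℝ p v = 0)
    (hw : inner ℝ p w = 0) :
    sphereCurv p u v w = (inner ℝ v w : ℝ) • u - (inner ℝ u w : ℝ) • v := by
  have hb : VectorField.lieBracket ℝ (fun q => tangentProj q u) (fun q => tangentProj q v) p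
      = 0 := by
    rw [VectorField.lieBracket, fderiv_tangentProj_left, fderiv_tangentProj_left]
    simp [tangentProj, hu, hv, real_inner_comm]
  have hc : sphereConn (VectorField.lieBracket ℝ (fun q => tangentProj q u)
      (fun q => tangentProj q v)) (fun q => tangentProj q w) p = 0 := by
    rw [sphereConn, hb, map_zero, tangentProj_zero]
  rw [sphereCurv, sphereCurvField, sphereConn_sphereConn_tangentProj hp hu hv hw,
    sphereConn_sphereConn_tangentProj hp hv hu hw, hc]
  abel

/-! ### The orthonormal frame in spherical coordinates -/

section Frame

/-- The point of the sphere with coordinates `(ρ, φ)`, as a vector. -/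
noncomputable def posVec (ρ φ : ℝ) : E3 :=
  !₂[Real.sin ρ, Real.cos ρ * Real.cos φ, Real.cos ρ * Real.sin φ]

/-- The unit tangent vector `∂/∂ρ` at the point `(ρ, φ)`. -/
noncomputable def frameRho (ρ φ : ℝ) : E3 :=
  !₂[Real.cos ρ, -(Real.sin ρ * Real.cos φ), -(Real.sin ρ * Real.sin φ)]

/-- The unit tangent vector `(cos ρ)⁻¹ ∂/∂φ` at the point `(ρ, φ)`; it does not depend on `ρ` and
makes sense at the poles as well. -/
noncomputable def framePhi (φ : ℝ) : E3 := !₂[0, -Real.sin φ, Real.cos φ]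

theorem inner_posVec_frameRho (ρ φ : ℝ) : inner ℝ (posVec ρ φ) (frameRho ρ φ) = 0 := by
  simp [posVec, frameRho, PiLp.inner_apply, Fin.sum_univ_three]
  linear_combination (-Real.sin ρ * Real.cos ρ) * Real.sin_sq_add_cos_sq φ

theorem inner_posVec_framePhi (ρ φ : ℝ) : inner ℝ (posVec ρ φ) (framePhi φ) = 0 := by
  simp [posVec, framePhi, PiLp.inner_apply, Fin.sum_univ_three]
  ring

theorem inner_frameRho_framePhi (ρ φ : ℝ) : inner ℝ (frameRho ρ φ) (framePhi φ) = 0 := by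
  simp [frameRho, framePhi, PiLp.inner_apply, Fin.sum_univ_three]
  ring

theorem inner_framePhi_frameRho (ρ φ : ℝ) : inner ℝ (framePhi φ) (frameRho ρ φ) = 0 := by
  rw [real_inner_comm, inner_frameRho_framePhi]

theorem norm_posVec (ρ φ : ℝ) : ‖posVec ρ φ‖ = 1 :=
  mem_sphere_zero_iff_norm.1 (spherePoint ρ φ).2

theorem inner_frameRho_self (ρ φ : ℝ) : inner ℝ (frameRho ρ φ) (frameRho ρ φ) = 1 := by
  simp only [frameRho, PiLp.inner_apply, Fin.sum_univ_three]
  simp [-inner_self_eq_norm_sq_to_K]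
  linear_combination Real.sin ρ ^ 2 * Real.sin_sq_add_cos_sq φ + Real.sin_sq_add_cos_sq ρ

theorem inner_framePhi_self (φ : ℝ) : inner ℝ (framePhi φ) (framePhi φ) = 1 := by
  simp only [framePhi, PiLp.inner_apply, Fin.sum_univ_three]
  simp

theorem frame_combination_eq_zero {ρ φ u v : ℝ} :
    u • frameRho ρ φ + v • framePhi φ = 0 ↔ u = 0 ∧ v = 0 := by
  refine ⟨fun h => ⟨?_, ?_⟩, by rintro ⟨rfl, rfl⟩; simp⟩
  · simpa only [inner_add_right, inner_smul_right, inner_frameRho_self, inner_frameRho_framePhi,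
      mul_one, mul_zero, add_zero, inner_zero_right] using congrArg (inner ℝ (frameRho ρ φ)) h
  · simpa only [inner_add_right, inner_smul_right, inner_framePhi_self, inner_framePhi_frameRho,
      mul_one, mul_zero, zero_add, inner_zero_right] using congrArg (inner ℝ (framePhi φ)) h

variable {i : Fin 2} {x : Plane} {ρ φ : Plane → ℝ} {ρ' φ' : ℝ}

theorem HasPartial.vec {f₀ f₁ f₂ : Plane → ℝ} {v₀ v₁ v₂ : ℝ} (h₀ : HasPartial i f₀ v₀ x)
    (h₁ : HasPartial i f₁ v₁ x) (h₂ : HasPartial i f₂ v₂ x) :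
    HasPartial i (fun y => (!₂[f₀ y, f₁ y, f₂ y] : E3)) !₂[v₀, v₁, v₂] x := by
  have e : ∀ s t u : ℝ, (!₂[s, t, u] : E3)
      = s • !₂[1, 0, 0] + t • !₂[0, 1, 0] + u • !₂[0, 0, 1] := by
    intro s t u
    ext j
    fin_cases j <;> simp
  have h := ((h₀.smul (hasPartial_const (!₂[1, 0, 0] : E3))).add
    (h₁.smul (hasPartial_const (!₂[0, 1, 0] : E3)))).add
    (h₂.smul (hasPartial_const (!₂[0, 0, 1] : E3)))
  simp only [smul_zero, zero_add, ← e] at h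
  exact h

theorem HasPartial.sin {u : Plane → ℝ} {u' : ℝ} (hu : HasPartial i u u' x) :
    HasPartial i (fun y => Real.sin (u y)) (Real.cos (u x) * u') x :=
  HasPartial.comp (Real.hasDerivAt_sin _) hu

theorem HasPartial.cos {u : Plane → ℝ} {u' : ℝ} (hu : HasPartial i u u' x) :
    HasPartial i (fun y => Real.cos (u y)) (-Real.sin (u x) * u') x :=
  HasPartial.comp (Real.hasDerivAt_cos _) hu

theorem HasPartial.neg {u : Plane → ℝ} {u' : ℝ} (hu : HasPartial i u u' x) :
    HasPartial i (fun y => -u y) (-u') x :=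
  (HasPartial.comp (hasDerivAt_neg _) hu).congr (by ring)

theorem hasPartial_posVec (hρ : HasPartial i ρ ρ' x) (hφ : HasPartial i φ φ' x) :
    HasPartial i (fun y => posVec (ρ y) (φ y))
      (ρ' • frameRho (ρ x) (φ x) + (Real.cos (ρ x) * φ') • framePhi (φ x)) x := by
  refine (HasPartial.vec hρ.sin (hρ.cos.mul hφ.cos) (hρ.cos.mul hφ.sin)).congr ?_
  ext j
  fin_cases j <;> simp [frameRho, framePhi] <;> ring

theorem hasPartial_frameRho (hρ : HasPartial i ρ ρ' x) (hφ : HasPartial i φ φ' x) :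
    HasPartial i (fun y => frameRho (ρ y) (φ y))
      (-ρ' • posVec (ρ x) (φ x) + (-Real.sin (ρ x) * φ') • framePhi (φ x)) x := by
  refine (HasPartial.vec hρ.cos (hρ.sin.mul hφ.cos).neg (hρ.sin.mul hφ.sin).neg).congr ?_
  ext j
  fin_cases j <;> simp [posVec, framePhi] <;> ring

theorem hasPartial_framePhi (ρ : ℝ) (hφ : HasPartial i φ φ' x) :
    HasPartial i (fun y => framePhi (φ y))
      (φ' • (-Real.cos ρ • posVec ρ (φ x) + Real.sin ρ • frameRho ρ (φ x))) x := by
  refine (HasPartial.vec (hasPartial_const 0) hφ.sin.neg hφ.cos).congr ?_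
  ext j
  fin_cases j <;> simp [posVec, frameRho]
  · ring
  · linear_combination (Real.cos (φ x) * φ') * Real.sin_sq_add_cos_sq ρ
  · linear_combination (Real.sin (φ x) * φ') * Real.sin_sq_add_cos_sq ρ

/-- The covariant derivative of a vector field along a map, in terms of its components in the
frame `frameRho`, `framePhi`. -/
theorem covAlong_frame {u v : Plane → ℝ} {u' v' : ℝ} (hρ : HasPartial i ρ ρ' x)
    (hφ : HasPartial i φ φ' x) (hu : HasPartial i u u' x) (hv : HasPartial i v v' x) :
    covAlong (fun y => posVec (ρ y) (φ y)) i
      (fun y => u y • frameRho (ρ y) (φ y) + v y • framePhi (φ y)) x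
    = (u' + Real.sin (ρ x) * φ' * v x) • frameRho (ρ x) (φ x)
      + (v' - Real.sin (ρ x) * φ' * u x) • framePhi (φ x) := by
  rw [covAlong, ((hu.smul (hasPartial_frameRho hρ hφ)).add
    (hv.smul (hasPartial_framePhi (ρ x) hφ))).2]
  simp only [tangentProj_add, tangentProj_smul, tangentProj_self (norm_posVec _ _),
    tangentProj_of_inner_eq_zero (inner_posVec_frameRho _ _),
    tangentProj_of_inner_eq_zero (inner_posVec_framePhi _ _)]
  module

theorem sphereCurv_frame (ρ φ u₁ u₂ v₁ v₂ : ℝ) :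
    sphereCurv (posVec ρ φ) (u₁ • frameRho ρ φ + u₂ • framePhi φ)
      (v₁ • frameRho ρ φ + v₂ • framePhi φ) (u₁ • frameRho ρ φ + u₂ • framePhi φ)
    = ((u₁ * v₁ + u₂ * v₂) * u₁ - (u₁ ^ 2 + u₂ ^ 2) * v₁) • frameRho ρ φ
      + ((u₁ * v₁ + u₂ * v₂) * u₂ - (u₁ ^ 2 + u₂ ^ 2) * v₂) • framePhi φ := by
  have h0 : ∀ s t : ℝ, inner ℝ (posVec ρ φ) (s • frameRho ρ φ + t • framePhi φ) = 0 := by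
    intro s t
    simp [inner_add_right, inner_smul_right, inner_posVec_frameRho, inner_posVec_framePhi]
  rw [sphereCurv_eq (norm_posVec _ _) (h0 _ _) (h0 _ _) (h0 _ _)]
  simp only [inner_add_left, inner_add_right, inner_smul_right, real_inner_smul_left,
    inner_frameRho_self, inner_framePhi_self, inner_frameRho_framePhi, inner_framePhi_frameRho]
  module

end Frame

/-! ### Christoffel symbols of the torus -/

section Torus

variable {k : ℝ}

/-- The metric of the torus in the angular coordinates of the plane. -/
noncomputable abbrev planeMetric (k : ℝ) (y : Plane) : Matrix (Fin 2) (Fin 2) ℝ :=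
  torusMetric k (toTorus y)

/-- The radius `k + cos r` of the parallels of the torus. -/
noncomputable def radius (k : ℝ) (y : Plane) : ℝ := k + Real.cos (y 0)

/-- The logarithmic derivative of the radius. -/
noncomputable def logDer (k : ℝ) (y : Plane) : ℝ := -Real.sin (y 0) / radius k y

theorem radius_pos (hk : 1 < k) (y : Plane) : 0 < radius k y := by
  unfold radius; linarith [Real.neg_one_le_cos (y 0)]

theorem planeMetric_eq (k : ℝ) (y : Plane) : planeMetric k y = !![1, 0; 0, radius k y ^ 2] := by
  simp [planeMetric, torusMetric, toTorus, radius]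

theorem planeMetric_inv (hk : 1 < k) (y : Plane) :
    (planeMetric k y)⁻¹ = !![1, 0; 0, (radius k y)⁻¹ ^ 2] := by
  have h := (radius_pos hk y).ne'
  rw [planeMetric_eq]
  refine Matrix.inv_eq_right_inv ?_
  ext i j
  fin_cases i <;> fin_cases j <;> simp [Matrix.mul_apply, Fin.sum_univ_two, h]

theorem hasPartial_radius_zero (x : Plane) : HasPartial 0 (radius k) (-Real.sin (x 0)) x :=
  ((hasPartial_const k).add (hasPartial_coord 0).cos).congr (by simp)

theorem hasPartial_radius_one (x : Plane) : HasPartial 1 (radius k) 0 x :=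
  ((hasPartial_const k).add (hasPartial_coord 0).cos).congr (by simp)

/-- The trace of `∇^F_i Ψ_j - Γ^l_{ij} Ψ_l` in the metric of the torus. -/
theorem torus_trace {V : Type*} [AddCommGroup V] [Module ℝ V] (hk : 1 < k) (x : Plane)
    (Φ : Fin 2 → Fin 2 → V) (Ψ : Fin 2 → V) :
    (∑ i, ∑ j, (planeMetric k x)⁻¹ i j •
      (Φ i j - ∑ l, christoffel (planeMetric k) l i j x • Ψ l))
    = Φ 0 0 + logDer k x • Ψ 0 + (radius k x)⁻¹ ^ 2 • Φ 1 1 := by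
  have hr := (radius_pos hk x).ne'
  have d0 : partialD 0 (fun y => radius k y ^ 2) x = 2 * radius k x * -Real.sin (x 0) :=
    (hasPartial_radius_zero x).pow_two.2
  have d1 : partialD 1 (fun y => radius k y ^ 2) x = 0 :=
    (hasPartial_radius_one x).pow_two.2.trans (by simp)
  have dc : ∀ (i : Fin 2) (t : ℝ), partialD i (fun _ => t) x = 0 := fun i t =>
    (hasPartial_const t).2
  simp only [christoffel, planeMetric_inv hk, Fin.sum_univ_two]
  simp only [planeMetric_eq]
  simp only [Matrix.of_apply, Matrix.cons_val', Matrix.cons_val_zero, Matrix.cons_val_one,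
    Matrix.cons_val_fin_one, dc, d0, d1]
  simp
  unfold logDer
  match_scalars <;> field_simp

end Torus

/-! ### Tension and bitension of the maps that are affine in the coordinates -/

section Model

/-- An affine function on the coordinate plane. -/
def affine (a b c : ℝ) (y : Plane) : ℝ := a * y 0 + b * y 1 + c

/-- The map `(r, θ) ↦ (ρ, φ) = (a r + b θ + c, m r + n θ + l)` into the sphere. -/
noncomputable def model (a b c m n l : ℝ) (y : Plane) : E3 :=
  posVec (affine a b c y) (affine m n l y)

/-- The `frameRho` component of the tension field, where `p` stands for the logarithmic derivative
of the radius `w = k + cos r`, `v` for `w⁻¹`, and `s`, `C` for `sin ρ`, `cos ρ`. -/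
def tensionRho (a m n p v s C : ℝ) : ℝ := a * p + s * C * (m ^ 2 + n ^ 2 * v ^ 2)

/-- The `framePhi` component of the tension field; `p`, `v`, `s`, `C` are as for `tensionRho`. -/
def tensionPhi (a b m n p v s C : ℝ) : ℝ := C * m * p - 2 * s * (a * m + b * n * v ^ 2)

/-- The derivative of `tensionRho` in a direction in which `p`, `v`, `ρ` have the derivatives
`p'`, `v'`, `ρ'`. -/
def tensionRhoDeriv (a m n v s C p' v' ρ' : ℝ) : ℝ :=
  a * p' + (C ^ 2 - s ^ 2) * ρ' * (m ^ 2 + n ^ 2 * v ^ 2) + 2 * s * C * n ^ 2 * v * v'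

/-- The derivative of `tensionPhi` in a direction in which `p`, `v`, `ρ` have the derivatives
`p'`, `v'`, `ρ'`. -/
def tensionPhiDeriv (a b m n p v s C p' v' ρ' : ℝ) : ℝ :=
  -s * ρ' * m * p + C * m * p' - 2 * C * ρ' * (a * m + b * n * v ^ 2) - 4 * s * b * n * v * v'

/-- The `frameRho` component of the bitension field. -/
def bitensionRho (k a b m n p v s C : ℝ) : ℝ :=
  a * ((k * (-p * v) - 2 * p * (k * v - 1 - p ^ 2)) + p * (k * v - 1 - p ^ 2))
    - 4 * (a ^ 2 + b ^ 2 * v ^ 2) * s * C * (m ^ 2 + n ^ 2 * v ^ 2)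
    - 4 * a * n ^ 2 * (C ^ 2 - s ^ 2) * p * v ^ 2
    + a * (C ^ 2 - s ^ 2) * p * (m ^ 2 + n ^ 2 * v ^ 2)
    + s * C * n ^ 2 * v ^ 2 * (2 - 2 * k * v + 4 * p ^ 2)
    + 2 * s * m * tensionPhiDeriv a b m n p v s C (k * v - 1 - p ^ 2) (-p * v) a
    + 2 * s * n * v ^ 2 * tensionPhiDeriv a b m n p v s C 0 0 b
    + p * s * m * tensionPhi a b m n p v s C
    + (C ^ 2 - s ^ 2) * (m ^ 2 + n ^ 2 * v ^ 2) * tensionRho a m n p v s C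

/-- The `framePhi` component of the bitension field. -/
def bitensionPhi (k a b m n p v s C : ℝ) : ℝ :=
  C * m * ((k * (-p * v) - 2 * p * (k * v - 1 - p ^ 2)) + p * (k * v - 1 - p ^ 2))
    - 2 * a * s * m * (k * v - 1 - p ^ 2) - a * s * m * p ^ 2
    - (a ^ 2 + b ^ 2 * v ^ 2) * C * m * p
    - 2 * a * C * p * (a * m + b * n * v ^ 2)
    + 2 * (a ^ 2 + b ^ 2 * v ^ 2) * s * (a * m + b * n * v ^ 2)
    + 8 * a * C * b * n * p * v ^ 2
    - 2 * s * b * n * v ^ 2 * (2 - 2 * k * v + 4 * p ^ 2)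
    - 2 * s * m * tensionRhoDeriv a m n v s C (k * v - 1 - p ^ 2) (-p * v) a
    - 2 * s * n * v ^ 2 * tensionRhoDeriv a m n v s C 0 0 b
    - p * s * m * tensionRho a m n p v s C
    - 2 * C * (a * m + b * n * v ^ 2) * tensionRho a m n p v s C
    + (a ^ 2 + b ^ 2 * v ^ 2 - s ^ 2 * (m ^ 2 + n ^ 2 * v ^ 2)) * tensionPhi a b m n p v s C

variable {k : ℝ} {i : Fin 2} {x : Plane} {p v ρ : Plane → ℝ} {p' v' ρ' : ℝ}

theorem hasPartial_affine_zero (a b c : ℝ) (x : Plane) : HasPartial 0 (affine a b c) a x :=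
  ((((hasPartial_const a).mul (hasPartial_coord 0)).add
    ((hasPartial_const b).mul (hasPartial_coord 1))).add (hasPartial_const c)).congr (by simp)

theorem hasPartial_affine_one (a b c : ℝ) (x : Plane) : HasPartial 1 (affine a b c) b x :=
  ((((hasPartial_const a).mul (hasPartial_coord 0)).add
    ((hasPartial_const b).mul (hasPartial_coord 1))).add (hasPartial_const c)).congr (by simp)

theorem hasPartial_inv_radius_zero (hk : 1 < k) (x : Plane) :
    HasPartial 0 (fun y => (radius k y)⁻¹) (-logDer k x * (radius k x)⁻¹) x := by
  refine (HasPartial.comp (hasDerivAt_inv (radius_pos hk x).ne')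
    (hasPartial_radius_zero x)).congr ?_
  unfold logDer
  field_simp

theorem hasPartial_inv_radius_one (hk : 1 < k) (x : Plane) :
    HasPartial 1 (fun y => (radius k y)⁻¹) 0 x :=
  (HasPartial.comp (hasDerivAt_inv (radius_pos hk x).ne')
    (hasPartial_radius_one x)).congr (by simp)

/-- The equation `p' = k v - 1 - p²`, which keeps all derivatives polynomial in `p`, `v`, `sin ρ`
and `cos ρ`. -/
theorem hasPartial_logDer_zero (hk : 1 < k) (x : Plane) :
    HasPartial 0 (logDer k) (k * (radius k x)⁻¹ - 1 - logDer k x ^ 2) x := by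
  refine ((hasPartial_coord 0).sin.neg.mul (hasPartial_inv_radius_zero hk x)).congr ?_
  have hr := (radius_pos hk x).ne'
  have hc : Real.cos (x 0) = radius k x - k := by unfold radius; ring
  simp only [hc, logDer]
  field_simp
  simp
  ring

theorem hasPartial_logDer_one (hk : 1 < k) (x : Plane) : HasPartial 1 (logDer k) 0 x :=
  ((hasPartial_coord 0).sin.neg.mul (hasPartial_inv_radius_one hk x)).congr (by simp)

theorem hasPartial_tensionRho (a m n : ℝ) (hp : HasPartial i p p' x) (hv : HasPartial i v v' x)
    (hρ : HasPartial i ρ ρ' x) :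
    HasPartial i (fun y => tensionRho a m n (p y) (v y) (Real.sin (ρ y)) (Real.cos (ρ y)))
      (tensionRhoDeriv a m n (v x) (Real.sin (ρ x)) (Real.cos (ρ x)) p' v' ρ') x := by
  unfold tensionRho
  refine HasPartial.congr (((hasPartial_const a).mul hp).add ((hρ.sin.mul hρ.cos).mul
    ((hasPartial_const (m ^ 2)).add ((hasPartial_const (n ^ 2)).mul hv.pow_two)))) ?_
  unfold tensionRhoDeriv
  ring

theorem hasPartial_tensionPhi (a b m n : ℝ) (hp : HasPartial i p p' x) (hv : HasPartial i v v' x)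
    (hρ : HasPartial i ρ ρ' x) :
    HasPartial i (fun y => tensionPhi a b m n (p y) (v y) (Real.sin (ρ y)) (Real.cos (ρ y)))
      (tensionPhiDeriv a b m n (p x) (v x) (Real.sin (ρ x)) (Real.cos (ρ x)) p' v' ρ') x := by
  unfold tensionPhi
  refine HasPartial.congr (((hρ.cos.mul (hasPartial_const m)).mul hp).sub
    (((hasPartial_const 2).mul hρ.sin).mul ((hasPartial_const (a * m)).add
      ((hasPartial_const (b * n)).mul hv.pow_two)))) ?_
  unfold tensionPhiDeriv
  ring

theorem hasPartial_tensionRhoDeriv (a m n : ℝ) {q u : Plane → ℝ} {q' u' : ℝ} (t : ℝ)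
    (hv : HasPartial i v v' x)
    (hρ : HasPartial i ρ ρ' x)
    (hq : HasPartial i q q' x) (hu : HasPartial i u u' x) :
    HasPartial i (fun y => tensionRhoDeriv a m n (v y) (Real.sin (ρ y)) (Real.cos (ρ y)) (q y) (u y) t)
      (a * q' - 4 * Real.sin (ρ x) * Real.cos (ρ x) * ρ' * t * (m ^ 2 + n ^ 2 * v x ^ 2)
        + 2 * (Real.cos (ρ x) ^ 2 - Real.sin (ρ x) ^ 2) * n ^ 2 * v x * (t * v' + ρ' * u x)
        + 2 * Real.sin (ρ x) * Real.cos (ρ x) * n ^ 2 * (v' * u x + v x * u')) x := by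
  unfold tensionRhoDeriv
  refine HasPartial.congr ((((hasPartial_const a).mul hq).add
    (((hρ.cos.pow_two.sub hρ.sin.pow_two).mul (hasPartial_const t)).mul
    ((hasPartial_const (m ^ 2)).add ((hasPartial_const (n ^ 2)).mul hv.pow_two)))).add
    (((((hasPartial_const 2).mul hρ.sin).mul hρ.cos).mul (hasPartial_const (n ^ 2))).mul hv |>.mul hu)) ?_
  ring

theorem hasPartial_tensionPhiDeriv (a b m n : ℝ) {q u : Plane → ℝ} {q' u' : ℝ} (t : ℝ)
    (hp : HasPartial i p p' x) (hv : HasPartial i v v' x)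
    (hρ : HasPartial i ρ ρ' x)
    (hq : HasPartial i q q' x) (hu : HasPartial i u u' x) :
    HasPartial i (fun y => tensionPhiDeriv a b m n (p y) (v y) (Real.sin (ρ y)) (Real.cos (ρ y)) (q y) (u y) t)
      (-Real.cos (ρ x) * ρ' * t * m * p x - Real.sin (ρ x) * m * (t * p' + ρ' * q x) + Real.cos (ρ x) * m * q'
        + 2 * Real.sin (ρ x) * ρ' * t * (a * m + b * n * v x ^ 2)
        - 4 * Real.cos (ρ x) * b * n * v x * (t * v' + ρ' * u x)
        - 4 * Real.sin (ρ x) * b * n * (v' * u x + v x * u')) x := by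
  unfold tensionPhiDeriv
  refine HasPartial.congr (((((hρ.sin.neg.mul (hasPartial_const t)).mul (hasPartial_const m)).mul
    hp).add ((hρ.cos.mul (hasPartial_const m)).mul hq)).sub
    ((((hasPartial_const 2).mul hρ.cos).mul (hasPartial_const t)).mul ((hasPartial_const (a * m)).add
      ((hasPartial_const (b * n)).mul hv.pow_two))) |>.sub
    ((((((hasPartial_const 4).mul hρ.sin).mul (hasPartial_const b)).mul
      (hasPartial_const n)).mul hv).mul hu)) ?_
  ring

theorem partialD_model_zero (a b c m n l : ℝ) :
    partialD 0 (model a b c m n l) = fun y => a • frameRho (affine a b c y) (affine m n l y)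
      + (Real.cos (affine a b c y) * m) • framePhi (affine m n l y) :=
  funext fun y =>
    (hasPartial_posVec (hasPartial_affine_zero a b c y) (hasPartial_affine_zero m n l y)).2

theorem partialD_model_one (a b c m n l : ℝ) :
    partialD 1 (model a b c m n l) = fun y => b • frameRho (affine a b c y) (affine m n l y)
      + (Real.cos (affine a b c y) * n) • framePhi (affine m n l y) :=
  funext fun y =>
    (hasPartial_posVec (hasPartial_affine_one a b c y) (hasPartial_affine_one m n l y)).2

/-- The tension field of the affine maps. -/
theorem tension_model (hk : 1 < k) (a b c m n l : ℝ) :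
    tension (planeMetric k) (model a b c m n l) = fun y =>
      tensionRho a m n (logDer k y) (radius k y)⁻¹ (Real.sin (affine a b c y))
          (Real.cos (affine a b c y)) • frameRho (affine a b c y) (affine m n l y)
        + tensionPhi a b m n (logDer k y) (radius k y)⁻¹ (Real.sin (affine a b c y))
          (Real.cos (affine a b c y)) • framePhi (affine m n l y) := by
  funext x
  rw [tension, torus_trace hk x
    (fun i j => covAlong (model a b c m n l) i (partialD j (model a b c m n l)) x)
    (fun j => partialD j (model a b c m n l) x)]
  have r0 := hasPartial_affine_zero a b c x
  have r1 := hasPartial_affine_one a b c x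
  have f0 := hasPartial_affine_zero m n l x
  have f1 := hasPartial_affine_one m n l x
  have h0 := covAlong_frame r0 f0 (hasPartial_const a) (r0.cos.mul (hasPartial_const m))
  have h1 := covAlong_frame r1 f1 (hasPartial_const b) (r1.cos.mul (hasPartial_const n))
  simp only [partialD_model_zero, partialD_model_one]
  unfold model
  erw [h0, h1]
  unfold tensionRho tensionPhi
  module

/-- The bitension field of the affine maps. -/
theorem bitension_model (hk : 1 < k) (a b c m n l : ℝ) (x : Plane) :
    bitension (planeMetric k) (model a b c m n l) x =
      bitensionRho k a b m n (logDer k x) (radius k x)⁻¹ (Real.sin (affine a b c x))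
          (Real.cos (affine a b c x)) • frameRho (affine a b c x) (affine m n l x)
        + bitensionPhi k a b m n (logDer k x) (radius k x)⁻¹ (Real.sin (affine a b c x))
          (Real.cos (affine a b c x)) • framePhi (affine m n l x) := by
  have r0 := hasPartial_affine_zero a b c
  have r1 := hasPartial_affine_one a b c
  have f0 := hasPartial_affine_zero m n l
  have f1 := hasPartial_affine_one m n l
  have p0 := hasPartial_logDer_zero hk
  have p1 := hasPartial_logDer_one hk
  have v0 := hasPartial_inv_radius_zero hk
  have v1 := hasPartial_inv_radius_one hk
  have c0 : covAlong (model a b c m n l) 0 (tension (planeMetric k) (model a b c m n l)) = fun y =>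
      (tensionRhoDeriv a m n (radius k y)⁻¹ (Real.sin (affine a b c y))
        (Real.cos (affine a b c y)) (k * (radius k y)⁻¹ - 1 - logDer k y ^ 2) (-logDer k y * (radius k y)⁻¹) a
        + Real.sin (affine a b c y) * m * tensionPhi a b m n (logDer k y) (radius k y)⁻¹ (Real.sin (affine a b c y))
        (Real.cos (affine a b c y)))
          • frameRho (affine a b c y) (affine m n l y)
      + (tensionPhiDeriv a b m n (logDer k y) (radius k y)⁻¹ (Real.sin (affine a b c y))
        (Real.cos (affine a b c y)) (k * (radius k y)⁻¹ - 1 - logDer k y ^ 2) (-logDer k y * (radius k y)⁻¹) a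
        - Real.sin (affine a b c y) * m * tensionRho a m n (logDer k y) (radius k y)⁻¹ (Real.sin (affine a b c y))
        (Real.cos (affine a b c y)))
          • framePhi (affine m n l y) :=
    funext fun y => by
      rw [tension_model hk]
      exact covAlong_frame (r0 y) (f0 y)
        (hasPartial_tensionRho a m n (p0 y) (v0 y) (r0 y))
        (hasPartial_tensionPhi a b m n (p0 y) (v0 y) (r0 y))
  have c1 : covAlong (model a b c m n l) 1 (tension (planeMetric k) (model a b c m n l)) = fun y =>
      (tensionRhoDeriv a m n (radius k y)⁻¹ (Real.sin (affine a b c y))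
        (Real.cos (affine a b c y)) 0 0 b
        + Real.sin (affine a b c y) * n * tensionPhi a b m n (logDer k y) (radius k y)⁻¹ (Real.sin (affine a b c y))
        (Real.cos (affine a b c y)))
          • frameRho (affine a b c y) (affine m n l y)
      + (tensionPhiDeriv a b m n (logDer k y) (radius k y)⁻¹ (Real.sin (affine a b c y))
        (Real.cos (affine a b c y)) 0 0 b
        - Real.sin (affine a b c y) * n * tensionRho a m n (logDer k y) (radius k y)⁻¹ (Real.sin (affine a b c y))
        (Real.cos (affine a b c y)))
          • framePhi (affine m n l y) :=
    funext fun y => by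
      rw [tension_model hk]
      exact covAlong_frame (r1 y) (f1 y)
        (hasPartial_tensionRho a m n (p1 y) (v1 y) (r1 y))
        (hasPartial_tensionPhi a b m n (p1 y) (v1 y) (r1 y))
  have A0 := hasPartial_tensionRho a m n (p0 x) (v0 x) (r0 x)
  have B0 := hasPartial_tensionPhi a b m n (p0 x) (v0 x) (r0 x)
  have A1 := hasPartial_tensionRho a m n (p1 x) (v1 x) (r1 x)
  have B1 := hasPartial_tensionPhi a b m n (p1 x) (v1 x) (r1 x)
  have q0 := (((hasPartial_const k).mul (v0 x)).sub (hasPartial_const 1)).sub (p0 x).pow_two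
  have u0 := (p0 x).neg.mul (v0 x)
  have AA0 := hasPartial_tensionRhoDeriv a m n a (v0 x) (r0 x) q0 u0
  have BB0 := hasPartial_tensionPhiDeriv a b m n a (p0 x) (v0 x) (r0 x) q0 u0
  have AA1 := hasPartial_tensionRhoDeriv a m n b (v1 x) (r1 x)
    (hasPartial_const 0) (hasPartial_const 0)
  have BB1 := hasPartial_tensionPhiDeriv a b m n b (p1 x) (v1 x) (r1 x)
    (hasPartial_const 0) (hasPartial_const 0)
  have d0 := covAlong_frame (r0 x) (f0 x)
    (AA0.add (((r0 x).sin.mul (hasPartial_const m)).mul B0))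
    (BB0.sub (((r0 x).sin.mul (hasPartial_const m)).mul A0))
  have d1 := covAlong_frame (r1 x) (f1 x)
    (AA1.add (((r1 x).sin.mul (hasPartial_const n)).mul B1))
    (BB1.sub (((r1 x).sin.mul (hasPartial_const n)).mul A1))
  rw [bitension, torus_trace hk x
    (fun i j => covAlong (model a b c m n l) i
      (covAlong (model a b c m n l) j (tension (planeMetric k) (model a b c m n l))) x)
    (fun j => covAlong (model a b c m n l) j (tension (planeMetric k) (model a b c m n l)) x)]
  simp only [c0, c1]
  simp only [planeMetric_inv hk, Fin.sum_univ_two, Matrix.of_apply, Matrix.cons_val',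
    Matrix.cons_val_zero, Matrix.cons_val_one, Matrix.cons_val_fin_one, zero_smul, one_smul,
    add_zero, zero_add, partialD_model_zero, partialD_model_one, tension_model hk]
  simp only [model, sphereCurv_frame] at d0 d1 ⊢
  erw [d0, d1]
  match_scalars
  · unfold bitensionRho tensionRho tensionPhi tensionRhoDeriv tensionPhiDeriv
    ring
  · unfold bitensionPhi tensionRho tensionPhi tensionRhoDeriv tensionPhiDeriv
    ring

end Model

/-! ### Growth of entire functions along the negative imaginary axis -/

section Growth

/-- Along `z = -iY`, `Y → ∞`, the function `f` behaves like `c e^{μ Y}`. For a trigonometric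
polynomial with no frequency above `μ`, the number `c` is the coefficient of `e^{iμz}`. -/
def HasLead (f : ℂ → ℂ) (μ : ℝ) (c : ℂ) : Prop :=
  Tendsto (fun Y : ℝ => f (-(Y * Complex.I)) * Complex.exp (-(μ * Y))) atTop (𝓝 c)

/-- Along `z = -iY`, `Y → ∞`, the function `f` is of order at most `e^{μ Y}`. -/
def HasOrder (f : ℂ → ℂ) (μ : ℝ) : Prop := ∃ c, HasLead f μ c

variable {f g : ℂ → ℂ} {μ ν : ℝ} {c d : ℂ}

theorem HasLead.hasOrder (h : HasLead f μ c) : HasOrder f μ := ⟨c, h⟩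

theorem HasLead.add (hf : HasLead f μ c) (hg : HasLead g μ d) :
    HasLead (fun z => f z + g z) μ (c + d) := by
  simpa only [HasLead, add_mul] using Tendsto.add hf hg

theorem HasLead.mul (hf : HasLead f μ c) (hg : HasLead g ν d) :
    HasLead (fun z => f z * g z) (μ + ν) (c * d) := by
  refine (Tendsto.mul hf hg).congr fun Y => ?_
  rw [mul_mul_mul_comm, ← Complex.exp_add]
  congr 2
  push_cast
  ring

theorem HasLead.const_mul (hf : HasLead f μ c) (t : ℂ) : HasLead (fun z => t * f z) μ (t * c) := by
  simpa only [HasLead, mul_assoc] using Tendsto.const_mul t hf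

theorem HasLead.pow (hf : HasLead f μ c) (j : ℕ) : HasLead (fun z => f z ^ j) (j * μ) (c ^ j) := by
  refine (Tendsto.pow hf j).congr fun Y => ?_
  rw [mul_pow, ← Complex.exp_nat_mul]
  congr 2
  push_cast
  ring

theorem HasOrder.hasLead_zero (hf : HasOrder f μ) (h : μ < ν) : HasLead f ν 0 := by
  obtain ⟨c, hc⟩ := hf
  have h1 : Tendsto (fun Y : ℝ => ((Real.exp (-((ν - μ) * Y)) : ℝ) : ℂ)) atTop (𝓝 ((0 : ℝ) : ℂ)) :=
    (Complex.continuous_ofReal.tendsto 0).comp (Real.tendsto_exp_neg_atTop_nhds_zero.comp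
      (tendsto_id.const_mul_atTop (sub_pos.2 h)))
  have h2 := Tendsto.mul hc h1
  simp only [Complex.ofReal_zero, mul_zero] at h2
  refine h2.congr fun Y => ?_
  rw [Complex.ofReal_exp, mul_assoc, ← Complex.exp_add]
  congr 2
  push_cast
  ring

theorem HasOrder.mono (hf : HasOrder f μ) (h : μ ≤ ν) : HasOrder f ν := by
  rcases h.eq_or_lt with rfl | h
  · exact hf
  · exact ⟨0, hf.hasLead_zero h⟩

theorem HasOrder.add (hf : HasOrder f μ) (hg : HasOrder g μ) : HasOrder (fun z => f z + g z) μ :=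
  ⟨_, hf.choose_spec.add hg.choose_spec⟩

theorem HasOrder.mul (hf : HasOrder f μ) (hg : HasOrder g ν) :
    HasOrder (fun z => f z * g z) (μ + ν) :=
  ⟨_, hf.choose_spec.mul hg.choose_spec⟩

theorem HasOrder.pow (hf : HasOrder f μ) (j : ℕ) : HasOrder (fun z => f z ^ j) (j * μ) :=
  ⟨_, hf.choose_spec.pow j⟩

theorem HasOrder.const_mul (hf : HasOrder f μ) (t : ℂ) : HasOrder (fun z => t * f z) μ :=
  ⟨_, hf.choose_spec.const_mul t⟩

theorem hasOrder_const (t : ℂ) : HasOrder (fun _ => t) 0 :=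
  ⟨t, by simp [HasLead]⟩

theorem HasLead.add_lower (hf : HasLead f μ c) (hg : HasOrder g ν) (h : ν < μ) :
    HasLead (fun z => f z + g z) μ c := by
  simpa using hf.add (hg.hasLead_zero h)

theorem HasLead.eq_zero (hf : HasLead f μ c) (h : ∀ z, f z = 0) : c = 0 := by
  simpa only [HasLead, h, zero_mul, tendsto_const_nhds_iff, eq_comm] using hf

theorem hasLead_exp (μ : ℝ) (t : ℂ) :
    HasLead (fun z => Complex.exp ((μ * z + t) * Complex.I)) μ (Complex.exp (t * Complex.I)) := by
  refine tendsto_const_nhds.congr fun Y => ?_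
  rw [← Complex.exp_add]
  congr 1
  linear_combination (μ * Y : ℂ) * Complex.I_mul_I

theorem hasLead_cos (h : 0 < μ) (t : ℂ) :
    HasLead (fun z => Complex.cos (μ * z + t)) μ (Complex.exp (t * Complex.I) / 2) := by
  have h1 := ((hasLead_exp μ t).const_mul (1 / 2)).add_lower
    ((hasLead_exp (-μ) (-t)).hasOrder.const_mul (1 / 2)) (neg_lt_self h)
  convert h1 using 1
  · funext z
    rw [Complex.cos, add_div]
    push_cast
    ring_nf
  · ring

theorem hasLead_sin (h : 0 < μ) (t : ℂ) :
    HasLead (fun z => Complex.sin (μ * z + t)) μ (-(Complex.exp (t * Complex.I) * Complex.I / 2)) := by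
  have h1 := ((hasLead_exp μ t).const_mul (-Complex.I / 2)).add_lower
    ((hasLead_exp (-μ) (-t)).hasOrder.const_mul (Complex.I / 2)) (neg_lt_self h)
  convert h1 using 1
  · funext z
    rw [Complex.sin]
    push_cast
    ring_nf
  · ring

/-- An entire function that vanishes on a nonempty open set of reals is zero. -/
theorem entire_eq_zero {H : ℂ → ℂ} (hH : Differentiable ℂ H) {t₀ : ℝ}
    (h : ∀ᶠ t : ℝ in 𝓝 t₀, H t = 0) (z : ℂ) : H z = 0 := by
  have hf : ∃ᶠ w in 𝓝[≠] (t₀ : ℂ), H w = 0 := by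
    have h1 : ∃ᶠ t : ℝ in 𝓝[≠] t₀, H t = 0 := (h.filter_mono nhdsWithin_le_nhds).frequently
    refine Tendsto.frequently ?_ h1
    refine tendsto_nhdsWithin_of_tendsto_nhds_of_eventually_within _
      ((Complex.continuous_ofReal.tendsto t₀).mono_left nhdsWithin_le_nhds) ?_
    filter_upwards [self_mem_nhdsWithin] with t ht
    simpa using ht
  have ha : AnalyticOnNhd ℂ H Set.univ := fun w _ => hH.analyticAt w
  exact congrFun (ha.eq_of_frequently_eq (g := fun _ => 0) (fun _ _ => analyticAt_const) hf) z

end Growth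

/-! ### The bitension field of the maps with `ρ = a r + c` -/

section Profile

/-- The function `w⁴ T`, where `w = k + cos r` and `T` is the `frameRho` component of the bitension
field of the map `(ρ, φ) = (a r + c, m r + n θ + l)`, extended to complex `r`. -/
noncomputable def profile (k a c m n : ℝ) (z : ℂ) : ℂ :=
  (a * (1 - k ^ 2)) * ((k + Complex.cos z) * -Complex.sin z)
  + (-2 * a * m ^ 2) * (-Complex.sin z * (k + Complex.cos z) ^ 3)
  + (4 * a * m ^ 2 * (-Complex.sin z * (k + Complex.cos z) ^ 3)
      + -2 * a * n ^ 2 * (-Complex.sin z * (k + Complex.cos z)))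
    * Complex.cos ((2 * a : ℝ) * z + (2 * c : ℝ))
  + ((-(4 * a ^ 2 * m ^ 2 + m ^ 2)) * (k + Complex.cos z) ^ 4
      + (k * m ^ 2) * (k + Complex.cos z) ^ 3
      + (n ^ 2 - 2 * a ^ 2 * n ^ 2) * (k + Complex.cos z) ^ 2
      + (-(k * n ^ 2)) * (k + Complex.cos z)
      + (2 * n ^ 2) * (-Complex.sin z) ^ 2
      + (-(m ^ 2 / 2)) * ((-Complex.sin z) ^ 2 * (k + Complex.cos z) ^ 2))
    * Complex.sin ((2 * a : ℝ) * z + (2 * c : ℝ))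
  + (1 / 4) * ((m ^ 2 * (k + Complex.cos z) ^ 2 + n ^ 2) ^ 2
    * Complex.sin ((4 * a : ℝ) * z + (4 * c : ℝ)))

theorem differentiable_profile (k a c m n : ℝ) : Differentiable ℂ (profile k a c m n) := by
  unfold profile
  fun_prop

/-- The reflection `ρ ↦ -ρ` is an isometry, which changes the sign of the `frameRho` component. -/
theorem profile_neg (k a c m n : ℝ) (z : ℂ) :
    profile k (-a) (-c) m n z = -profile k a c m n z := by
  have h : ∀ t : ℝ, ((t * -a : ℝ) : ℂ) * z + ((t * -c : ℝ) : ℂ)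
      = -(((t * a : ℝ) : ℂ) * z + ((t * c : ℝ) : ℂ)) := by
    intro t; push_cast; ring
  unfold profile
  rw [h, h, Complex.cos_neg, Complex.sin_neg, Complex.sin_neg]
  push_cast
  ring

/-- The real form of `profile`, with `u = w'` and with the double and quadruple angles of `ρ`
written in `s = sin ρ` and `C = cos ρ`. -/
theorem bitensionRho_mul_pow {k a m n w u s C : ℝ} (hw : w ≠ 0) (hu : u ^ 2 + (w - k) ^ 2 = 1)
    (hs : s ^ 2 + C ^ 2 = 1) :
    bitensionRho k a 0 m n (u / w) w⁻¹ s C * w ^ 4 =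
      a * (1 - k ^ 2) * (w * u) + -2 * a * m ^ 2 * (u * w ^ 3)
      + (4 * a * m ^ 2 * (u * w ^ 3) + -2 * a * n ^ 2 * (u * w)) * (2 * C ^ 2 - 1)
      + (-(4 * a ^ 2 * m ^ 2 + m ^ 2) * w ^ 4 + k * m ^ 2 * w ^ 3
          + (n ^ 2 - 2 * a ^ 2 * n ^ 2) * w ^ 2 + -(k * n ^ 2) * w + 2 * n ^ 2 * u ^ 2
          + -(m ^ 2 / 2) * (u ^ 2 * w ^ 2)) * (2 * s * C)
      + 1 / 4 * ((m ^ 2 * w ^ 2 + n ^ 2) ^ 2 * (2 * (2 * s * C) * (2 * C ^ 2 - 1))) := by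
  have hK : 2 * C ^ 2 - 1 = C ^ 2 - s ^ 2 := by linarith
  rw [hK]
  unfold bitensionRho tensionRho tensionPhi tensionPhiDeriv
  field_simp
  linear_combination (-8 * a * m ^ 2 * u * w ^ 3) * hs + (4 * a * w * u) * hu

theorem ofReal_bitensionRho (hk : 1 < k) (a c m n r : ℝ) :
    ((bitensionRho k a 0 m n (-Real.sin r / (k + Real.cos r)) (k + Real.cos r)⁻¹
      (Real.sin (a * r + c)) (Real.cos (a * r + c)) * (k + Real.cos r) ^ 4 : ℝ) : ℂ)
    = profile k a c m n r := by
  have hw : k + Real.cos r ≠ 0 := by linarith [Real.neg_one_le_cos r]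
  have h2 : ((2 * a : ℝ) : ℂ) * r + (2 * c : ℝ) = 2 * ((a * r + c : ℝ) : ℂ) := by push_cast; ring
  have h4 : ((4 * a : ℝ) : ℂ) * r + (4 * c : ℝ) = 2 * (2 * ((a * r + c : ℝ) : ℂ)) := by
    push_cast; ring
  rw [bitensionRho_mul_pow hw (by linear_combination Real.sin_sq_add_cos_sq r)
    (Real.sin_sq_add_cos_sq _), profile, h2, h4, Complex.sin_two_mul (2 * _),
    Complex.sin_two_mul, Complex.cos_two_mul]
  push_cast
  ring

theorem hasLead_radius (k : ℝ) : HasLead (fun z => k + Complex.cos z) 1 (1 / 2) := by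
  have h := (hasLead_cos one_pos 0).add_lower (hasOrder_const k) one_pos
  simpa [add_comm] using h

theorem hasLead_neg_sin : HasLead (fun z => -Complex.sin z) 1 (Complex.I / 2) := by
  have h := (hasLead_sin one_pos 0).const_mul (-1)
  simpa using h

/-- For `m ≠ 0` the highest frequency of the profile is `4a + 4`. -/
theorem eq_zero_of_profile_eq_zero {k a c m n : ℝ} (ha : 0 < a)
    (h : ∀ z, profile k a c m n z = 0) : m = 0 := by
  by_contra hm
  have hw := hasLead_radius k
  have hu := hasLead_neg_sin
  have ow := hw.hasOrder
  have ou := hu.hasOrder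
  have hs := hasLead_sin (show 0 < 4 * a by linarith) ((4 * c : ℝ) : ℂ)
  have os := (hasLead_sin (show 0 < 2 * a by linarith) ((2 * c : ℝ) : ℂ)).hasOrder
  have oc := (hasLead_cos (show 0 < 2 * a by linarith) ((2 * c : ℝ) : ℂ)).hasOrder
  have o1 : HasOrder (fun z => (k + Complex.cos z) * -Complex.sin z) 4 :=
    (ow.mul ou).mono (by norm_num)
  have o1' : HasOrder (fun z => -Complex.sin z * (k + Complex.cos z)) 4 :=
    (ou.mul ow).mono (by norm_num)
  have o2 : HasOrder (fun z => -Complex.sin z * (k + Complex.cos z) ^ 3) 4 :=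
    (ou.mul (ow.pow 3)).mono (by norm_num)
  have w4 : HasOrder (fun z => (k + Complex.cos z) ^ 4) 4 := (ow.pow 4).mono (by norm_num)
  have w3 : HasOrder (fun z => (k + Complex.cos z) ^ 3) 4 := (ow.pow 3).mono (by norm_num)
  have w2 : HasOrder (fun z => (k + Complex.cos z) ^ 2) 4 := (ow.pow 2).mono (by norm_num)
  have w1 : HasOrder (fun z => k + Complex.cos z) 4 := ow.mono (by norm_num)
  have u2 : HasOrder (fun z => (-Complex.sin z) ^ 2) 4 := (ou.pow 2).mono (by norm_num)
  have uw : HasOrder (fun z => (-Complex.sin z) ^ 2 * (k + Complex.cos z) ^ 2) 4 :=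
    ((ou.pow 2).mul (ow.pow 2)).mono (by norm_num)
  have lower := ((((o1.const_mul (a * (1 - k ^ 2))).add (o2.const_mul (-2 * a * m ^ 2))).mono
      (show (4 : ℝ) ≤ 4 + 2 * a by linarith)).add
    (((o2.const_mul (4 * a * m ^ 2)).add (o1'.const_mul (-2 * a * n ^ 2))).mul oc)).add
    (((((((w4.const_mul (-(4 * a ^ 2 * m ^ 2 + m ^ 2))).add (w3.const_mul (k * m ^ 2))).add
      (w2.const_mul (n ^ 2 - 2 * a ^ 2 * n ^ 2))).add (w1.const_mul (-(k * n ^ 2)))).add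
      (u2.const_mul (2 * n ^ 2))).add (uw.const_mul (-(m ^ 2 / 2)))).mul os)
  have lead := ((((((hw.pow 2).const_mul (m ^ 2)).add_lower (hasOrder_const (n ^ 2))
    (by norm_num)).pow 2).mul hs).const_mul (1 / 4)).add_lower lower (by norm_num; linarith)
  have := lead.eq_zero fun z => by rw [← h z, profile]; ring
  simp [hm] at this

theorem profile_zero_of_eq_zero (k a c n : ℝ) (z : ℂ) : profile k a c 0 n z =
    (a * (1 - k ^ 2)) * ((k + Complex.cos z) * -Complex.sin z)
    + (-2 * a * n ^ 2) * (((k + Complex.cos z) * -Complex.sin z)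
        * Complex.cos ((2 * a : ℝ) * z + (2 * c : ℝ)))
    + n ^ 2 * (((1 - 2 * a ^ 2) * (k + Complex.cos z) ^ 2 + 2 * (-Complex.sin z) ^ 2
        + (-k) * (k + Complex.cos z)) * Complex.sin ((2 * a : ℝ) * z + (2 * c : ℝ)))
    + (n ^ 4 / 4) * Complex.sin ((4 * a : ℝ) * z + (4 * c : ℝ)) := by
  unfold profile
  push_cast
  ring

theorem exists_profile_ne_zero_of_pos {k a : ℝ} (hk : 1 < k) (ha : 0 < a) (c m n : ℝ) :
    ∃ z, profile k a c m n z ≠ 0 := by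
  by_contra! h
  obtain rfl := eq_zero_of_profile_eq_zero ha h
  have hk2 : (1 : ℂ) - k ^ 2 ≠ 0 := by
    have : (1 : ℝ) - k ^ 2 ≠ 0 := by nlinarith
    exact_mod_cast this
  have ha0 : (a : ℂ) ≠ 0 := by exact_mod_cast ha.ne'
  have hk0 : (k : ℂ) ≠ 0 := by exact_mod_cast (by linarith : k ≠ 0)
  rcases eq_or_ne n 0 with rfl | hn
  · have := h (Real.pi / 2 : ℝ)
    rw [profile_zero_of_eq_zero] at this
    simp [ha0, hk2, hk0] at this
  have hn0 : (n : ℂ) ≠ 0 := by exact_mod_cast hn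
  simp only [profile_zero_of_eq_zero] at h
  have hw := hasLead_radius k
  have hu := hasLead_neg_sin
  have hs4 := hasLead_sin (show 0 < 4 * a by linarith) ((4 * c : ℝ) : ℂ)
  have hs2 := hasLead_sin (show 0 < 2 * a by linarith) ((2 * c : ℝ) : ℂ)
  have hc2 := hasLead_cos (show 0 < 2 * a by linarith) ((2 * c : ℝ) : ℂ)
  have hwu := hw.mul hu
  have hq := ((((hw.pow 2).const_mul (1 - 2 * a ^ 2)).add ((hu.pow 2).const_mul 2)).add_lower
    (hw.hasOrder.const_mul (-k)) (by norm_num)).mul hs2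
  rw [show ((2 : ℕ) : ℝ) * 1 + 2 * a = 1 + 1 + 2 * a by norm_num] at hq
  have h2 := ((hwu.mul hc2).const_mul (-2 * a * n ^ 2)).add (hq.const_mul (n ^ 2))
  have h4 := hs4.const_mul (n ^ 4 / 4)
  have h0 := hwu.const_mul (a * (1 - k ^ 2))
  rcases lt_trichotomy a 1 with ha1 | rfl | ha1
  · -- the highest frequency is `2a + 2`
    have := ((h2.add_lower h4.hasOrder (by linarith)).add_lower h0.hasOrder
      (by linarith)).eq_zero fun z => by rw [← h z]; ring
    have e : Complex.I ^ 2 = -1 := Complex.I_sq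
    have h1 : (n : ℂ) ^ 2 * Complex.exp ((2 * c : ℝ) * Complex.I) * Complex.I
        * (2 * a ^ 2 - 2 * a + 1) = 0 := by
      linear_combination 8 * this
        + 2 * (n : ℂ) ^ 2 * Complex.exp ((2 * c : ℝ) * Complex.I) * Complex.I * e
    have h3 : (2 : ℂ) * a ^ 2 - 2 * a + 1 ≠ 0 := by
      have : (2 : ℝ) * a ^ 2 - 2 * a + 1 ≠ 0 := by nlinarith [sq_nonneg (a - 1)]
      exact_mod_cast this
    simp [hn0, h3] at h1
  · -- the frequencies `2a + 2` and `4a` coincide; the odd part has the highest frequency `3`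
    have odd : ∀ z : ℂ, (-2 * n ^ 2) * (-Complex.sin z * Complex.cos ((2 * 1 : ℝ) * z + (2 * c : ℝ)))
        + (-3 * n ^ 2) * (Complex.cos z * Complex.sin ((2 * 1 : ℝ) * z + (2 * c : ℝ)))
        + (1 - k ^ 2) * -Complex.sin z = 0 := by
      intro z
      have e2 : ((2 * 1 : ℝ) : ℂ) * (z + Real.pi) + (2 * c : ℝ)
          = (2 * 1 : ℝ) * z + (2 * c : ℝ) + 2 * Real.pi := by push_cast; ring
      have e4 : ((4 * 1 : ℝ) : ℂ) * (z + Real.pi) + (4 * c : ℝ)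
          = (4 * 1 : ℝ) * z + (4 * c : ℝ) + 2 * Real.pi + 2 * Real.pi := by push_cast; ring
      have h1 := h (z + Real.pi)
      rw [e2, e4, Complex.sin_add_two_pi, Complex.sin_add_two_pi, Complex.sin_add_two_pi,
        Complex.cos_add_two_pi, Complex.sin_add_pi, Complex.cos_add_pi] at h1
      refine mul_left_cancel₀ (mul_ne_zero two_ne_zero hk0) ?_
      have h0 := h z
      rw [Complex.ofReal_one] at h0 h1
      linear_combination h0 - h1
    have hc : HasLead Complex.cos 1 (1 / 2) := by simpa using hasLead_cos one_pos 0
    have := ((((hu.mul hc2).const_mul (-2 * n ^ 2)).add ((hc.mul hs2).const_mul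
      (-3 * n ^ 2))).add_lower (hu.hasOrder.const_mul (1 - k ^ 2)) (by norm_num)).eq_zero odd
    have h1 : (n : ℂ) ^ 2 * Complex.exp ((2 * c : ℝ) * Complex.I) * Complex.I = 0 := by
      linear_combination 4 * this
    simp [hn0] at h1
  · -- the highest frequency is `4a`
    have := ((h4.add_lower h2.hasOrder (by linarith)).add_lower h0.hasOrder
      (by linarith)).eq_zero fun z => by rw [← h z]; ring
    simp [hn0] at this

/-- No map with `ρ = a r + c`, `a ≠ 0`, has vanishing bitension. -/
theorem exists_profile_ne_zero {k a : ℝ} (hk : 1 < k) (ha : a ≠ 0) (c m n : ℝ) :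
    ∃ z, profile k a c m n z ≠ 0 := by
  rcases ha.lt_or_gt with h | h
  · obtain ⟨z, hz⟩ := exists_profile_ne_zero_of_pos hk (neg_pos.2 h) (-c) m n
    exact ⟨z, by simpa [profile_neg] using hz⟩
  · exact exists_profile_ne_zero_of_pos hk h c m n

end Profile

/-! ### Vanishing bitension forces vanishing tension -/

section Rigidity

variable {k : ℝ}

theorem eventually_coord_zero {P : Plane → Prop} {x₀ : Plane} (h : ∀ᶠ x in 𝓝 x₀, P x) :
    ∀ᶠ r in 𝓝 (x₀ 0), P ![r, x₀ 1] := by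
  have hx : ![x₀ 0, x₀ 1] = x₀ := by ext i; fin_cases i <;> rfl
  have hc : Continuous fun r : ℝ => (![r, x₀ 1] : Plane) := by fun_prop
  exact (hc.tendsto' _ _ hx).eventually h

/-- For `b ≠ 0`, the functions `r` and `ρ = a r + b θ + c` are coordinates of the plane. -/
theorem eventually_coord_affine {P : ℝ → ℝ → Prop} {a b c : ℝ} (hb : b ≠ 0) {x₀ : Plane}
    (h : ∀ᶠ x in 𝓝 x₀, P (x 0) (affine a b c x)) :
    ∀ᶠ r in 𝓝 (x₀ 0), ∀ᶠ ρ in 𝓝 (affine a b c x₀), P r ρ := by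
  have hc : Continuous fun q : ℝ × ℝ => (![q.1, (q.2 - c - a * q.1) / b] : Plane) := by fun_prop
  have hx : ![x₀ 0, (affine a b c x₀ - c - a * x₀ 0) / b] = x₀ := by
    ext i
    fin_cases i
    · rfl
    · simp [affine]; field_simp
  have h1 := (hc.tendsto' (x₀ 0, affine a b c x₀) x₀ hx).eventually h
  rw [nhds_prod_eq] at h1
  refine h1.curry.mono fun r hr => hr.mono fun ρ hρ => ?_
  have e : affine a b c ![r, (ρ - c - a * r) / b] = ρ := by
    simp only [affine, Matrix.cons_val_zero, Matrix.cons_val_one]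
    field_simp
    ring
  simpa only [e, Matrix.cons_val_zero] using hρ

theorem fourth_harmonic_eq_zero {α β γ δ ρ₀ : ℝ}
    (h : ∀ᶠ ρ in 𝓝 ρ₀, α + β * Real.cos (2 * ρ) + γ * Real.sin (2 * ρ) + δ * Real.sin (4 * ρ) = 0) :
    δ = 0 := by
  have h0 := entire_eq_zero (H := fun z => δ * Complex.sin ((4 : ℝ) * z + 0)
      + ((α + β * Complex.cos ((2 : ℝ) * z + 0)) + γ * Complex.sin ((2 : ℝ) * z + 0)))
    (by fun_prop) (h.mono fun ρ hρ => by
      have := congrArg (fun t : ℝ => (t : ℂ)) hρ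
      push_cast at this ⊢
      simp only [add_zero]
      linear_combination this)
  have lower := (((hasOrder_const α).mono zero_le_two).add
    ((hasLead_cos two_pos 0).hasOrder.const_mul β)).add
    ((hasLead_sin two_pos 0).hasOrder.const_mul γ)
  have := (((hasLead_sin four_pos 0).const_mul δ).add_lower lower (by norm_num)).eq_zero h0
  simpa using this

/-- The dependence of the `frameRho` component on `ρ`; its fourth harmonic comes from the cubic
term `cos 2ρ |∇φ|² τ` with `|∇φ|² = m² + n² w⁻²`. -/
theorem bitensionRho_harmonics (k a b m n p v : ℝ) : ∃ α β γ : ℝ, ∀ ρ : ℝ,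
    bitensionRho k a b m n p v (Real.sin ρ) (Real.cos ρ) = α + β * Real.cos (2 * ρ)
      + γ * Real.sin (2 * ρ) + (m ^ 2 + n ^ 2 * v ^ 2) ^ 2 / 4 * Real.sin (4 * ρ) := by
  -- `L` and `M` are `⟨∇ρ, ∇φ⟩` and `|∇φ|²`, and `X` collects the multiples of `sin² ρ`.
  let L := a * m + b * n * v ^ 2
  let M := m ^ 2 + n ^ 2 * v ^ 2
  let X := -2 * a * m ^ 2 * p + 8 * b * m * n * p * v ^ 2 - 2 * v ^ 2 * n * b * m * p - 2 * m * p * L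
  refine ⟨a * ((k * (-p * v) - 2 * p * (k * v - 1 - p ^ 2)) + p * (k * v - 1 - p ^ 2)) + X / 2,
    -X / 2 + 2 * a * M * p - 4 * a * n ^ 2 * p * v ^ 2,
    (-4 * (a ^ 2 + b ^ 2 * v ^ 2) * M + n ^ 2 * v ^ 2 * (2 - 2 * k * v + 4 * p ^ 2)) / 2
      + m ^ 2 * (k * v - 1 - p ^ 2) - 2 * a * m * L - 2 * v ^ 2 * n * b * L + m ^ 2 * p ^ 2 / 2,
    fun ρ => ?_⟩
  have h4 : Real.sin (4 * ρ) = 2 * (2 * Real.sin ρ * Real.cos ρ)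
      * (Real.cos ρ ^ 2 - Real.sin ρ ^ 2) := by
    rw [show 4 * ρ = 2 * (2 * ρ) by ring, Real.sin_two_mul, Real.sin_two_mul, Real.cos_two_mul']
  rw [h4, Real.sin_two_mul, Real.cos_two_mul']
  simp only [bitensionRho, tensionRho, tensionPhi, tensionPhiDeriv, X, L, M]
  linear_combination ((-2 * a * m ^ 2 * p + 8 * b * m * n * p * v ^ 2 - 2 * v ^ 2 * n * b * m * p
    - 2 * m * p * (a * m + b * n * v ^ 2)) / 2) * Real.sin_sq_add_cos_sq ρ

theorem not_eventually_sin_eq_zero (r₀ : ℝ) : ¬ ∀ᶠ r in 𝓝 r₀, Real.sin r = 0 := fun h => by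
  have := entire_eq_zero Complex.differentiable_sin
    (h.mono fun r hr => by rw [← Complex.ofReal_sin, hr, Complex.ofReal_zero]) (Real.pi / 2)
  simp at this

theorem logDer_sq (hk : 1 < k) (x : Plane) :
    logDer k x ^ 2 = (radius k x)⁻¹ ^ 2 - (1 - k * (radius k x)⁻¹) ^ 2 := by
  have hr := (radius_pos hk x).ne'
  have h := Real.sin_sq_add_cos_sq (x 0)
  have hc : Real.cos (x 0) = radius k x - k := by unfold radius; ring
  rw [hc] at h
  unfold logDer
  field_simp
  linear_combination h

/-- If `ρ` depends on `θ`, vanishing bitension leaves only the maps with `ρ = b θ + c` and `φ`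
constant, which send the torus to a great circle and depend on `θ` alone. -/
theorem coeffs_eq_zero_of_ne_zero (hk : 1 < k) {a b c m n : ℝ} (hb : b ≠ 0) {x₀ : Plane}
    (h : ∀ᶠ x in 𝓝 x₀, bitensionRho k a b m n (logDer k x) (radius k x)⁻¹
      (Real.sin (affine a b c x)) (Real.cos (affine a b c x)) = 0) :
    a = 0 ∧ m = 0 ∧ n = 0 := by
  have h1 := (eventually_coord_affine (P := fun r ρ => bitensionRho k a b m n
    (-Real.sin r / (k + Real.cos r)) (k + Real.cos r)⁻¹ (Real.sin ρ) (Real.cos ρ) = 0) hb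
    h).self_of_nhds
  -- One parallel `r = x₀ 0` is enough to read off the fourth harmonic in `ρ`.
  obtain ⟨α, β, γ, hρ⟩ := bitensionRho_harmonics k a b m n
    (-Real.sin (x₀ 0) / (k + Real.cos (x₀ 0))) (k + Real.cos (x₀ 0))⁻¹
  simp only [hρ] at h1
  have h2 := fourth_harmonic_eq_zero h1
  have hv : 0 < (k + Real.cos (x₀ 0))⁻¹ := inv_pos.2 (radius_pos hk x₀)
  have h3 : m ^ 2 + n ^ 2 * (k + Real.cos (x₀ 0))⁻¹ ^ 2 = 0 := by
    simpa using h2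
  have hm : m = 0 := by
    have := sq_nonneg (n * (k + Real.cos (x₀ 0))⁻¹)
    nlinarith [sq_nonneg m]
  have hn : n = 0 := by
    simpa [hm, (inv_pos.1 hv).ne'] using h3
  subst hm hn
  refine ⟨?_, rfl, rfl⟩
  by_contra ha
  refine not_eventually_sin_eq_zero (x₀ 0) ((eventually_coord_zero h).mono fun r hr => ?_)
  have hr0 := (radius_pos hk ![r, x₀ 1]).ne'
  have e : bitensionRho k a b 0 0 (logDer k ![r, x₀ 1]) (radius k ![r, x₀ 1])⁻¹
      (Real.sin (affine a b c ![r, x₀ 1])) (Real.cos (affine a b c ![r, x₀ 1]))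
      = a * (1 - k ^ 2) * (radius k ![r, x₀ 1])⁻¹ ^ 2 * logDer k ![r, x₀ 1] := by
    simp only [bitensionRho, tensionRho, tensionPhi, tensionPhiDeriv]
    linear_combination (a * logDer k ![r, x₀ 1]) * logDer_sq hk ![r, x₀ 1]
  have hk2 : 1 - k ^ 2 ≠ 0 := by nlinarith
  rw [e] at hr
  simpa [ha, hk2, hr0, logDer] using hr

theorem bitensionPhi_const_mul_pow {m n w u s C : ℝ} (hw : w ≠ 0)
    (hu : u ^ 2 + (w - k) ^ 2 = 1) :
    bitensionPhi k 0 0 m n (u / w) w⁻¹ s C * w ^ 3 =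
      C * m * (u * ((1 - k ^ 2 + 2 * s ^ 2 * n ^ 2) - 2 * s ^ 2 * m ^ 2 * w ^ 2)) := by
  unfold bitensionPhi tensionRho tensionPhi tensionRhoDeriv
  field_simp
  linear_combination (w * C * m * u) * hu

/-- The case of constant `ρ`, with `s = sin ρ` and `C = cos ρ`. The `framePhi` component gives
`C m = 0`, and then the `frameRho` component gives `s C n = 0`. -/
theorem tension_eq_zero_of_const (hk : 1 < k) {m n s C : ℝ} (hs : s ^ 2 + C ^ 2 = 1) {x₀ : Plane}
    (h1 : ∀ᶠ x in 𝓝 x₀, bitensionRho k 0 0 m n (logDer k x) (radius k x)⁻¹ s C = 0)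
    (h2 : ∀ᶠ x in 𝓝 x₀, bitensionPhi k 0 0 m n (logDer k x) (radius k x)⁻¹ s C = 0) :
    C * m = 0 ∧ s * C * n = 0 := by
  have hk2 : 1 - k ^ 2 ≠ 0 := by nlinarith
  have hsq : ∀ r : ℝ, (-Real.sin r) ^ 2 + (k + Real.cos r - k) ^ 2 = 1 := fun r => by
    linear_combination Real.sin_sq_add_cos_sq r
  have hCm : C * m = 0 := by
    by_contra hne
    have h : ∀ r : ℝ, Real.sin r * ((1 - k ^ 2 + 2 * s ^ 2 * n ^ 2)
        - 2 * s ^ 2 * m ^ 2 * (k + Real.cos r) ^ 2) = 0 := fun r => by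
      have := entire_eq_zero (H := fun z => Complex.sin z *
        ((1 - k ^ 2 + 2 * s ^ 2 * n ^ 2) - 2 * s ^ 2 * m ^ 2 * (k + Complex.cos z) ^ 2))
        (by fun_prop) ((eventually_coord_zero h2).mono fun r hr => by
          have e := bitensionPhi_const_mul_pow (m := m) (n := n) (s := s) (C := C)
            (radius_pos hk ![r, x₀ 1]).ne' (hsq r)
          rw [logDer, Matrix.cons_val_zero] at hr
          rw [hr, zero_mul, eq_comm, mul_eq_zero, or_iff_right hne, neg_mul, neg_eq_zero] at e
          simp only [radius, Matrix.cons_val_zero] at e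
          exact_mod_cast e) r
      exact_mod_cast this
    -- The second factor is a polynomial in `(k + cos r)²`; two values of `r` give its coefficients.
    have ha := h (Real.pi / 2)
    have hb := h (Real.pi / 3)
    rw [Real.sin_pi_div_two, Real.cos_pi_div_two] at ha
    rw [Real.sin_pi_div_three, Real.cos_pi_div_three, mul_eq_zero,
      or_iff_right (by positivity)] at hb
    have hm : m ≠ 0 := right_ne_zero_of_mul hne
    have hE : s ^ 2 * m ^ 2 * (2 * (k + 1 / 4)) = 0 := by linear_combination ha - hb
    have hs0 : s = 0 := by
      have : k + 4⁻¹ ≠ 0 := by linarith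
      simpa [hm, this] using hE
    rw [hs0] at ha
    exact hk2 (by linear_combination ha)
  refine ⟨hCm, ?_⟩
  by_contra hne
  have hC : C ≠ 0 := right_ne_zero_of_mul (left_ne_zero_of_mul hne)
  have hn : n ≠ 0 := right_ne_zero_of_mul hne
  obtain rfl : m = 0 := (mul_eq_zero.1 hCm).resolve_left hC
  have h : ∀ r : ℝ, 2 * ((k + Real.cos r) ^ 2 - k * (k + Real.cos r) + 2 * Real.sin r ^ 2)
      + n ^ 2 * (2 * C ^ 2 - 1) = 0 := fun r => by
    have := entire_eq_zero (H := fun z => 2 * ((k + Complex.cos z) ^ 2 - k * (k + Complex.cos z)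
        + 2 * Complex.sin z ^ 2) + n ^ 2 * (2 * C ^ 2 - 1))
      (by fun_prop) ((eventually_coord_zero h1).mono fun r hr => by
        have e := bitensionRho_mul_pow (a := 0) (m := 0) (n := n) (s := s) (C := C)
          (radius_pos hk ![r, x₀ 1]).ne' (hsq r) hs
        rw [logDer, Matrix.cons_val_zero] at hr
        rw [hr, zero_mul] at e
        simp only [radius, Matrix.cons_val_zero] at e
        have e' : 2 * ((k + Real.cos r) ^ 2 - k * (k + Real.cos r) + 2 * Real.sin r ^ 2)
            + n ^ 2 * (2 * C ^ 2 - 1) = 0 := by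
          refine mul_left_cancel₀ (mul_ne_zero hne hn) ?_
          linear_combination -e
        exact_mod_cast e') r
    exact_mod_cast this
  have ha := h 0
  have hb := h Real.pi
  simp only [Real.cos_zero, Real.sin_zero, Real.cos_pi, Real.sin_pi] at ha hb
  linarith

/-- Along the affine maps, both components of the tension field vanish at a point near which
both components of the bitension field vanish. -/
theorem tension_eq_zero_of_bitension_eq_zero (hk : 1 < k) {a b c m n : ℝ} {x₀ : Plane}
    (h1 : ∀ᶠ x in 𝓝 x₀, bitensionRho k a b m n (logDer k x) (radius k x)⁻¹
      (Real.sin (affine a b c x)) (Real.cos (affine a b c x)) = 0)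
    (h2 : ∀ᶠ x in 𝓝 x₀, bitensionPhi k a b m n (logDer k x) (radius k x)⁻¹
      (Real.sin (affine a b c x)) (Real.cos (affine a b c x)) = 0) :
    tensionRho a m n (logDer k x₀) (radius k x₀)⁻¹
      (Real.sin (affine a b c x₀)) (Real.cos (affine a b c x₀)) = 0 ∧
    tensionPhi a b m n (logDer k x₀) (radius k x₀)⁻¹
      (Real.sin (affine a b c x₀)) (Real.cos (affine a b c x₀)) = 0 := by
  rcases ne_or_eq b 0 with hb | rfl
  · obtain ⟨rfl, rfl, rfl⟩ := coeffs_eq_zero_of_ne_zero hk hb h1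
    simp [tensionRho, tensionPhi]
  rcases ne_or_eq a 0 with ha | rfl
  · obtain ⟨z, hz⟩ := exists_profile_ne_zero hk ha c m n
    refine absurd (entire_eq_zero (differentiable_profile k a c m n)
      ((eventually_coord_zero h1).mono fun r hr => ?_) z) hz
    rw [← ofReal_bitensionRho hk, Complex.ofReal_eq_zero]
    simp [affine, logDer, radius] at hr ⊢
    simp [hr]
  · have hρ : ∀ x, affine 0 0 c x = c := fun x => by simp [affine]
    simp only [hρ] at h1 h2 ⊢
    obtain ⟨hm, hn⟩ := tension_eq_zero_of_const hk (Real.sin_sq_add_cos_sq c) h1 h2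
    constructor
    · unfold tensionRho
      linear_combination (Real.sin c * m) * hm + (n * (radius k x₀)⁻¹ ^ 2) * hn
    · unfold tensionPhi
      linear_combination (logDer k x₀) * hm

/-- Harmonic maps are biharmonic, in a form local to a point of the plane. -/
theorem bitension_eq_zero_of_tension_eventually_eq_zero {F : Plane → E3} {x : Plane}
    {g : Plane → Matrix (Fin 2) (Fin 2) ℝ} (h : tension g F =ᶠ[𝓝 x] 0) : bitension g F x = 0 := by
  have hz : ∀ (i : Fin 2) (y : Plane), covAlong F i (fun _ => 0) y = 0 := fun i y => by
    rw [covAlong, (hasPartial_const 0).2, tangentProj_zero]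
  have h1 : ∀ i, covAlong F i (tension g F) =ᶠ[𝓝 x] fun _ => 0 := fun i =>
    (covAlong_congr EventuallyEq.rfl h i).trans (Eventually.of_forall (hz i))
  have h2 : ∀ i j, covAlong F i (covAlong F j (tension g F)) x = 0 := fun i j =>
    (covAlong_congr EventuallyEq.rfl (h1 j) i).eq_of_nhds.trans (hz i x)
  have h3 : ∀ u w, sphereCurv (F x) u 0 w = 0 := fun u w => by
    have e : ∀ X Z : E3 → E3, ∀ p, X p = 0 → sphereConn X Z p = 0 := fun X Z p hp => by
      simp [sphereConn, hp, tangentProj_zero]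
    have e0 : (fun q : E3 => tangentProj q 0) = fun _ => 0 := funext tangentProj_zero
    have e1 : ∀ Z : E3 → E3, sphereConn (fun _ => 0) Z = fun _ => 0 := fun Z =>
      funext fun p => e _ _ p rfl
    have e2 : VectorField.lieBracket ℝ (fun q => tangentProj q u) (fun _ => (0 : E3)) (F x) = 0 := by
      simp [VectorField.lieBracket]
    rw [sphereCurv, sphereCurvField, e0, e1, e _ _ _ e2, e1]
    simp [sphereConn, tangentProj_zero]
  simp [bitension, h2, (h1 _).eq_of_nhds, h.eq_of_nhds, h3]

end Rigidity

/-- Near a point over the image of `W`, the map is again one of the affine maps: the deck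
transformations of the covering of the torus only change the constants `c` and `l`. -/
theorem exists_eventually_lift_eq_model {a b c m n l : ℝ} {W : Set Plane} (hW : IsOpen W)
    {f : T2 → S2} (hf : ∀ x ∈ W, f (toTorus x) =
      spherePoint (a * x 0 + b * x 1 + c) (m * x 0 + n * x 1 + l))
    {x : Plane} (hx : toTorus x ∈ toTorus '' W) :
    ∃ c' l', ∀ᶠ y in 𝓝 x, toTorus y ∈ toTorus '' W ∧ lift f y = model a b c' m n l' y := by
  obtain ⟨w, hw, hwx⟩ := hx
  have hc : Continuous fun y : Plane => y - x + w := by fun_prop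
  have hmem : ∀ᶠ y in 𝓝 x, y - x + w ∈ W :=
    (hc.tendsto' x w (by simp)).eventually (hW.mem_nhds hw)
  refine ⟨a * (w 0 - x 0) + b * (w 1 - x 1) + c, m * (w 0 - x 0) + n * (w 1 - x 1) + l,
    hmem.mono fun y hy => ?_⟩
  have ht : toTorus (y - x + w) = toTorus y := by
    simp only [toTorus, Prod.mk.injEq, Pi.add_apply, Pi.sub_apply, Real.Angle.coe_add,
      Real.Angle.coe_sub] at hwx ⊢
    simp [hwx.1, hwx.2]
  refine ⟨⟨_, hy, ht⟩, ?_⟩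
  rw [lift, ← ht, hf _ hy]
  simp only [model, affine, Pi.add_apply, Pi.sub_apply]
  change posVec _ _ = _
  congr 1 <;> ring

end TorusSphere

theorem theorem4p1 (k : ℝ) (hk : 1 < k) (a b c m n l : ℝ)
    (W : Set TorusSphere.Plane) (hW : IsOpen W)
    (f : TorusSphere.T2 → TorusSphere.S2)
    (hf : ∀ x ∈ W, f (TorusSphere.toTorus x) =
      TorusSphere.spherePoint (a * x 0 + b * x 1 + c) (m * x 0 + n * x 1 + l)) :
    TorusSphere.IsBiharmonicOn (TorusSphere.torusMetric k) f (TorusSphere.toTorus '' W) ↔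
      TorusSphere.IsHarmonicOn (TorusSphere.torusMetric k) f (TorusSphere.toTorus '' W) := by
  refine and_congr_right fun _ => ⟨fun h x hx => ?_, fun h x hx => ?_⟩
  · obtain ⟨c', l', hloc⟩ := TorusSphere.exists_eventually_lift_eq_model hW hf hx
    have hT : ∀ᶠ y in nhds x, TorusSphere.bitension (TorusSphere.planeMetric k)
        (TorusSphere.model a b c' m n l') y = 0 := by
      filter_upwards [hloc, hloc.eventually_nhds] with y hy hy'
      rw [← TorusSphere.bitension_congr (hy'.mono fun z hz => hz.2)]
      exact h y hy.1
    simp only [TorusSphere.bitension_model hk, TorusSphere.frame_combination_eq_zero] at hT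
    rw [(TorusSphere.tension_congr (hloc.mono fun y hy => hy.2)).eq_of_nhds]
    erw [TorusSphere.tension_model hk]
    exact TorusSphere.frame_combination_eq_zero.2
      (TorusSphere.tension_eq_zero_of_bitension_eq_zero hk (hT.mono fun y hy => hy.1)
        (hT.mono fun y hy => hy.2))
  · obtain ⟨c', l', hloc⟩ := TorusSphere.exists_eventually_lift_eq_model hW hf hx
    exact TorusSphere.bitension_eq_zero_of_tension_eventually_eq_zero
      (hloc.mono fun y hy => h y hy.1)
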